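/- Let $n\ge 0$ and let $\chi(\mathbb R^n)$ be the real vector space of $C^\infty$ vector fields on $\mathbb R^n$, identified with smooth maps $\mathbb R^n\to\mathbb R^n$, with the left pre-Lie product $(X\rhd Y)(x)=dY(x)(X(x))$, i.e. $(f_i\partial_i)\rhd(g_j\partial_j)=f_i(\partial_i g_j)\partial_j$. Let $\mathcal T$ be the free left pre-Lie algebra on the vector space $\chi(\mathbb R^n)$: given any basis $b$ of $\chi(\mathbb R^n)$, it has as a basis the (non-planar) rooted trees with vertices decorated by elements of $b$, and its product $s\to t$ is the sum, over the vertices of $t$, of the trees obtained by grafting $s$ at this vertex. A rooted tree with vertices decorated by arbitrary vector fields is viewed as an element of $\mathcal T$ by expanding all its decorations multilinearly over $b$. Write $B_+^X(t_1,\ldots,t_k)$ for the tree obtained by grafting the trees $t_1,\ldots,t_k$ on a common root decorated by $X$, and $\bullet_X$ for the one-vertex tree decorated by $X$ (the case $k=0$). There is a unique pre-Lie algebra morphism $\mathcal Y:\mathcal T\to\chi(\mathbb R^n)$ (the Cayley map) such that $\mathcal Y(\bullet_X)=X$ for any vector field $X$. It satisfies: for any $k\ge 0$, any trees $t_1,\ldots,t_k$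 with vertices decorated by vector fields, any vector field $X=\sum_{i=1}^n f_i\partial_i$ and any $x\in\mathbb R^n$, the vector field $\mathcal Y(t)=\sum_{i=1}^n\mathcal Y_i(t)\partial_i$ associated with $t=B_+^{X}(t_1,\ldots,t_k)$ is given by $$\mathcal Y_i(t)(x)=f_i^{(k)}(x)\big(\mathcal Y(t_1)(x),\ldots,\mathcal Y(t_k)(x)\big),\qquad i=1,\ldots,n,$$ where $f_i^{(k)}(x)$ is the $k$-th differential of $f_i$ at $x$, a symmetric $k$-linear form on $\mathbb R^n$ (with $f_i^{(0)}=f_i$). -/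

import Mathlib

open scoped ContDiff

namespace CayleyMap

universe u v

/-! ### Rooted trees with decorated vertices -/

/-- Planar rooted trees with vertices decorated by `D`: a root decorated by `d`, with an ordered
family of `k` branches. -/
inductive PlanarTree (D : Type u) : Type u
  | node (d : D) (k : ℕ) (c : Fin k → PlanarTree D) : PlanarTree D

/-- Two planar decorated trees are isomorphic as (non-planar) decorated rooted trees if they differ
by permutations of the branches at the various vertices. -/
inductive PlanarTree.Iso {D : Type u} : PlanarTree D → PlanarTree D → Prop
  | node (d : D) (k : ℕ) (c c' : Fin k → PlanarTree D) (σ : Equiv.Perm (Fin k))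
      (h : ∀ i, PlanarTree.Iso (c i) (c' (σ i))) :
      PlanarTree.Iso (PlanarTree.node d k c) (PlanarTree.node d k c')

theorem PlanarTree.Iso.refl {D : Type u} (t : PlanarTree D) : PlanarTree.Iso t t := by
  induction t with
  | node d k c ih => exact .node d k c c 1 ih

theorem PlanarTree.Iso.symm {D : Type u} {s t : PlanarTree D} (h : PlanarTree.Iso s t) :
    PlanarTree.Iso t s := by
  induction h with
  | node d k c c' σ _ ih =>
    refine .node d k c' c σ⁻¹ fun i => ?_
    have := ih (σ⁻¹ i)
    simpa using this

theorem PlanarTree.Iso.trans {D : Type u} {s t r : PlanarTree D} (h : PlanarTree.Iso s t)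
    (h' : PlanarTree.Iso t r) : PlanarTree.Iso s r := by
  induction h generalizing r with
  | node d k c c' σ _ ih =>
    cases h' with
    | node _ _ _ c'' τ h2 => exact .node d k c c'' (τ * σ) fun i => ih i (h2 (σ i))

instance PlanarTree.setoid (D : Type u) : Setoid (PlanarTree D) where
  r := PlanarTree.Iso
  iseqv := ⟨PlanarTree.Iso.refl, PlanarTree.Iso.symm, PlanarTree.Iso.trans⟩

/-- (Non-planar) rooted trees with vertices decorated by `D`, up to isomorphism. -/
def DecTree (D : Type u) : Type u := Quotient (PlanarTree.setoid D)

namespace DecTree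

variable {D : Type u}

/-- The rooted tree underlying a planar rooted tree. -/
def mk (t : PlanarTree D) : DecTree D := Quotient.mk _ t

/-- The tree `B_+^d(t_1, …, t_k)`, obtained by grafting `t_1, …, t_k` on a common root
decorated by `d`. -/
noncomputable def bPlus (d : D) {k : ℕ} (t : Fin k → DecTree D) : DecTree D :=
  mk (.node d k fun i => (t i).out)

theorem mk_node (d : D) (k : ℕ) (c : Fin k → PlanarTree D) :
    mk (.node d k c) = bPlus d fun i => mk (c i) :=
  Quotient.sound (.node d k _ _ 1 fun i => Setoid.symm (Quotient.mk_out (c i)))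

theorem bPlus_perm (d : D) {k : ℕ} (t : Fin k → DecTree D) (σ : Equiv.Perm (Fin k)) :
    bPlus d (fun i => t (σ i)) = bPlus d t :=
  Quotient.sound (.node d k _ _ σ fun _ => .refl _)

/-- Every decorated rooted tree is of the form `B_+^d(t_1, …, t_k)`. -/
theorem induction_bPlus {P : DecTree D → Prop}
    (h : ∀ (d : D) (k : ℕ) (t : Fin k → DecTree D), (∀ i, P (t i)) → P (bPlus d t))
    (t : DecTree D) : P t := by
  induction t using Quotient.inductionOn with
  | h t =>
    induction t with
    | node d k c ih =>
      have := h d k (fun i => mk (c i)) ih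
      rwa [← mk_node] at this

/-- The one-vertex tree with vertex decorated by `d`. -/
noncomputable def bullet (d : D) : DecTree D := bPlus d Fin.elim0

/-- The graftings of `s` at the vertices of a planar tree: either on the root, or at a vertex
of the `i`-th branch. -/
noncomputable def graftPlanar (s : DecTree D) : PlanarTree D → Multiset (DecTree D)
  | .node d _ c =>
    bPlus d (Fin.cons s fun i => mk (c i) : Fin _ → DecTree D) ::ₘ
      ∑ i, (graftPlanar s (c i)).map fun w =>
        bPlus d (Function.update (fun j => mk (c j)) i w)

theorem graftPlanar_iso (s : DecTree D) {t t' : PlanarTree D} (h : PlanarTree.Iso t t') :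
    graftPlanar s t = graftPlanar s t' := by
  induction h with
  | node d k c c' σ h ih =>
    have hc : (fun i => mk (c i)) = fun i => mk (c' (σ i)) :=
      funext fun i => Quotient.sound (h i)
    rw [graftPlanar, graftPlanar, hc]
    congr 1
    · rw [← bPlus_perm d (Fin.cons s fun i => mk (c' i) : Fin _ → DecTree D)
        (Equiv.Perm.decomposeFin.symm (0, σ))]
      congr 1
      funext i
      refine Fin.cases ?_ (fun j => ?_) i <;> simp
    · symm
      rw [← Equiv.sum_comp σ]
      symm
      refine Finset.sum_congr rfl fun i _ => ?_
      rw [ih i]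
      refine Multiset.map_congr rfl fun w _ => ?_
      rw [← bPlus_perm d (Function.update (fun j => mk (c' j)) (σ i) w) σ]
      congr 1
      funext j
      by_cases hj : j = i
      · subst hj; simp
      · simp [Function.update_of_ne hj, Function.update_of_ne (σ.injective.ne hj)]

/-- The trees obtained by grafting `s` on `t` at all the vertices of `t`, one for each vertex
of `t` (counted with multiplicity). -/
noncomputable def graft (s t : DecTree D) : Multiset (DecTree D) :=
  Quotient.lift (graftPlanar s) (fun _ _ h => graftPlanar_iso s h) t

theorem graft_bPlus (s : DecTree D) (d : D) {k : ℕ} (t : Fin k → DecTree D) :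
    graft s (bPlus d t) = bPlus d (Fin.cons s t : Fin (k + 1) → DecTree D) ::ₘ
      ∑ i, (graft s (t i)).map fun w => bPlus d (Function.update t i w) := by
  obtain ⟨c, rfl⟩ : ∃ c : Fin k → PlanarTree D, t = fun i => mk (c i) :=
    ⟨fun i => (t i).out, funext fun i => (Quotient.out_eq (t i)).symm⟩
  rw [← mk_node]
  rfl

theorem bind_sum {α β κ : Type*} (S : Finset κ) (f : κ → Multiset α) (g : α → Multiset β) :
    (∑ i ∈ S, f i).bind g = ∑ i ∈ S, (f i).bind g := by
  classical
  induction S using Finset.induction_on with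
  | empty => simp
  | insert a S ha ih => simp [Finset.sum_insert ha, Multiset.add_bind, ih]

theorem bind_sum_right {α β κ : Type*} (S : Finset κ) (m : Multiset α)
    (g : κ → α → Multiset β) :
    m.bind (fun a => ∑ i ∈ S, g i a) = ∑ i ∈ S, m.bind (g i) := by
  classical
  induction S using Finset.induction_on with
  | empty => simp
  | insert a S ha ih => simp [Finset.sum_insert ha, Multiset.bind_add, ih]

theorem graft_graft_bPlus (s t : DecTree D) (d : D) {k : ℕ} (c : Fin k → DecTree D) :
    (graft t (bPlus d c)).bind (graft s) =
      {bPlus d (Fin.cons s (Fin.cons t c : Fin (k + 1) → DecTree D) : Fin (k + 2) → DecTree D)} +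
      (graft s t).map (fun w => bPlus d (Fin.cons w c : Fin (k + 1) → DecTree D)) +
      ∑ i, (graft s (c i)).map
        (fun w => bPlus d (Fin.cons t (Function.update c i w) : Fin (k + 1) → DecTree D)) +
      ∑ i, (graft t (c i)).map
        (fun w => bPlus d (Fin.cons s (Function.update c i w) : Fin (k + 1) → DecTree D)) +
      ∑ i, ((graft t (c i)).bind (graft s)).map (fun w => bPlus d (Function.update c i w)) +
      ∑ i, ∑ j ∈ Finset.univ.erase i, (graft t (c i)).bind (fun v => (graft s (c j)).map
        (fun w => bPlus d (Function.update (Function.update c i v) j w))) := by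
  have key : ∀ i v, graft s (bPlus d (Function.update c i v)) =
      {bPlus d (Fin.cons s (Function.update c i v) : Fin (k + 1) → DecTree D)} +
      ((graft s v).map (fun w => bPlus d (Function.update c i w)) +
      ∑ j ∈ Finset.univ.erase i, (graft s (c j)).map
        (fun w => bPlus d (Function.update (Function.update c i v) j w))) := by
    intro i v
    rw [graft_bPlus, ← Multiset.singleton_add, ← Finset.add_sum_erase _ _ (Finset.mem_univ i)]
    congr 2
    · simp
    · refine Finset.sum_congr rfl fun j hj => ?_
      rw [Function.update_of_ne (Finset.ne_of_mem_erase hj)]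
  rw [graft_bPlus t, Multiset.cons_bind, graft_bPlus s, Fin.sum_univ_succ, bind_sum]
  simp only [Multiset.bind_map, key, Multiset.bind_add, bind_sum_right, Finset.sum_add_distrib,
    Fin.cons_zero, Fin.cons_succ, Fin.update_cons_zero, ← Fin.cons_update,
    Multiset.map_bind, Multiset.bind_singleton, ← Multiset.singleton_add]
  abel

/-- The left pre-Lie identity for grafting, at the level of trees. -/
theorem graft_preLie (s t r : DecTree D) :
    (graft t r).bind (graft s) + (graft t s).bind (fun v => graft v r) =
      (graft s r).bind (graft t) + (graft s t).bind (fun v => graft v r) := by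
  induction r using induction_bPlus with
  | h d k c ih =>
    have swap : ∑ i, ∑ j ∈ Finset.univ.erase i, (graft t (c i)).bind (fun v =>
          (graft s (c j)).map
            (fun w => bPlus d (Function.update (Function.update c i v) j w))) =
        ∑ i, ∑ j ∈ Finset.univ.erase i, (graft s (c i)).bind (fun v => (graft t (c j)).map
          (fun w => bPlus d (Function.update (Function.update c i v) j w))) := by
      rw [Finset.sum_comm' (t' := Finset.univ) (s' := fun j => Finset.univ.erase j)
        (by simp [eq_comm])]
      refine Finset.sum_congr rfl fun i _ => Finset.sum_congr rfl fun j hj => ?_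
      rw [Multiset.bind_map_comm]
      refine Multiset.bind_congr fun v _ => Multiset.map_congr rfl fun w _ => ?_
      rw [Function.update_comm (Finset.ne_of_mem_erase hj)]
    have hd : ∀ p q : DecTree D, (graft p q).bind (fun v => graft v (bPlus d c)) =
        (graft p q).map (fun w => bPlus d (Fin.cons w c : Fin (k + 1) → DecTree D)) +
        ∑ i, ((graft p q).bind (fun v => graft v (c i))).map
          (fun w => bPlus d (Function.update c i w)) := by
      intro p q
      simp only [graft_bPlus, ← Multiset.singleton_add, Multiset.bind_add, bind_sum_right,
        Multiset.bind_singleton, Multiset.map_bind]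
    have hs : bPlus d (Fin.cons s (Fin.cons t c : Fin (k + 1) → DecTree D) :
          Fin (k + 2) → DecTree D) =
        bPlus d (Fin.cons t (Fin.cons s c : Fin (k + 1) → DecTree D) :
          Fin (k + 2) → DecTree D) := by
      rw [← bPlus_perm d (Fin.cons t (Fin.cons s c : Fin (k + 1) → DecTree D) :
          Fin (k + 2) → DecTree D) (Equiv.swap 0 1)]
      congr 1
      funext i
      refine Fin.cases ?_ (fun j => Fin.cases ?_ (fun l => ?_) j) i
      · simp
      · simp
      · rw [Equiv.swap_apply_of_ne_of_ne (Fin.succ_ne_zero _)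
          (by simp [Fin.ext_iff])]
        simp
    have hsum : ∑ i, ((graft t (c i)).bind (graft s)).map
          (fun w => bPlus d (Function.update c i w)) +
        ∑ i, ((graft t s).bind (fun v => graft v (c i))).map
          (fun w => bPlus d (Function.update c i w)) =
        ∑ i, ((graft s (c i)).bind (graft t)).map
          (fun w => bPlus d (Function.update c i w)) +
        ∑ i, ((graft s t).bind (fun v => graft v (c i))).map
          (fun w => bPlus d (Function.update c i w)) := by
      simp only [← Finset.sum_add_distrib, ← Multiset.map_add, ih]
    rw [graft_graft_bPlus s t, graft_graft_bPlus t s, hd, hd, swap, hs]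
    generalize ∑ i, ((graft t (c i)).bind (graft s)).map _ = a1 at hsum ⊢
    generalize ∑ i, ((graft t s).bind (fun v => graft v (c i))).map _ = a2 at hsum ⊢
    generalize ∑ i, ((graft s (c i)).bind (graft t)).map _ = a3 at hsum ⊢
    generalize ∑ i, ((graft s t).bind (fun v => graft v (c i))).map _ = a4 at hsum ⊢
    generalize ({bPlus d _} : Multiset (DecTree D)) = e0
    generalize (graft s t).map _ = e1
    generalize (graft t s).map _ = e2
    generalize ∑ i, (graft s (c i)).map _ = e3
    generalize ∑ i, (graft t (c i)).map _ = e4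
    generalize ∑ i : Fin k, ∑ j ∈ Finset.univ.erase i, (_ : Multiset (DecTree D)) = e5
    calc _ = (a1 + a2) + (e0 + e1 + e3 + e4 + e5 + e2) := by abel
      _ = (a3 + a4) + (e0 + e1 + e3 + e4 + e5 + e2) := by rw [hsum]
      _ = _ := by abel

end DecTree

/-! ### The pre-Lie algebra of rooted trees -/

/-- The real vector space with basis the rooted trees decorated by `ι`, which carries the pre-Lie
product given by grafting. If `ι` indexes a basis of a vector space `V`, this is the free pre-Lie
algebra on `V`. -/
def TreeAlgebra (ι : Type u) : Type u := DecTree ι →₀ ℝ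

namespace TreeAlgebra

variable {ι : Type u}

noncomputable instance : AddCommGroup (TreeAlgebra ι) :=
  inferInstanceAs (AddCommGroup (DecTree ι →₀ ℝ))

noncomputable instance : Module ℝ (TreeAlgebra ι) :=
  inferInstanceAs (Module ℝ (DecTree ι →₀ ℝ))

/-- The basis element of `TreeAlgebra ι` given by a tree. -/
noncomputable def ofTree (t : DecTree ι) : TreeAlgebra ι := Finsupp.single t (1 : ℝ)

/-- The pre-Lie product `s → t`, bilinear, given on trees by the sum of the graftings of `s` on `t`
at all vertices of `t`. -/
noncomputable def graftL : TreeAlgebra ι →ₗ[ℝ] TreeAlgebra ι →ₗ[ℝ] TreeAlgebra ι :=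
  Finsupp.linearCombination ℝ fun s : DecTree ι =>
    (Finsupp.linearCombination ℝ fun t : DecTree ι => ((DecTree.graft s t).map ofTree).sum :
      TreeAlgebra ι →ₗ[ℝ] TreeAlgebra ι)

noncomputable instance : NonUnitalNonAssocRing (TreeAlgebra ι) where
  mul s t := graftL s t
  left_distrib s t r := map_add (graftL s) t r
  right_distrib s t r := by
    change graftL (s + t) r = graftL s r + graftL t r
    rw [map_add, LinearMap.add_apply]
  zero_mul s := by
    change graftL 0 s = 0
    rw [map_zero, LinearMap.zero_apply]
  mul_zero s := map_zero (graftL s)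

theorem mul_def (s t : TreeAlgebra ι) : s * t = graftL s t := rfl

theorem ofTree_mul_ofTree (s t : DecTree ι) :
    ofTree s * ofTree t = ((DecTree.graft s t).map ofTree).sum := by
  rw [mul_def, graftL, ofTree, ofTree]
  erw [Finsupp.linearCombination_single, one_smul, Finsupp.linearCombination_single, one_smul]

theorem ofTree_mul_sum (s : DecTree ι) (m : Multiset (DecTree ι)) :
    ofTree s * (m.map ofTree).sum = ((m.bind (DecTree.graft s)).map ofTree).sum := by
  induction m using Multiset.induction_on with
  | empty => simp
  | cons t m ih => simp [mul_add, ih, ofTree_mul_ofTree]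

theorem sum_mul_ofTree (t : DecTree ι) (m : Multiset (DecTree ι)) :
    (m.map ofTree).sum * ofTree t =
      ((m.bind fun s => DecTree.graft s t).map ofTree).sum := by
  induction m using Multiset.induction_on with
  | empty => simp
  | cons s m ih => simp [add_mul, ih, ofTree_mul_ofTree]

instance : IsScalarTower ℝ (TreeAlgebra ι) (TreeAlgebra ι) where
  smul_assoc a s t := by
    change graftL (a • s) t = a • graftL s t
    rw [map_smul, LinearMap.smul_apply]

instance : SMulCommClass ℝ (TreeAlgebra ι) (TreeAlgebra ι) where
  smul_comm a s t := by
    change a • graftL s t = graftL s (a • t)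
    rw [map_smul]

theorem induction_ofTree {P : TreeAlgebra ι → Prop} (s : TreeAlgebra ι) (h0 : P 0)
    (hadd : ∀ s t, P s → P t → P (s + t)) (h : ∀ (a : ℝ) t, P (a • ofTree t)) : P s := by
  refine Finsupp.induction_linear (motive := P) s h0 (fun f g => hadd f g) fun t a => ?_
  have := h a t
  have e : a • ofTree t = (Finsupp.single t a : DecTree ι →₀ ℝ) := by
    change a • (Finsupp.single t (1 : ℝ) : DecTree ι →₀ ℝ) = _
    simp
  rwa [e] at this

theorem preLie_ofTree (s t r : DecTree ι) :
    associator (ofTree s) (ofTree t) (ofTree r) =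
      associator (ofTree t) (ofTree s) (ofTree r) := by
  have h := congrArg (fun m => (m.map (ofTree (ι := ι))).sum) (DecTree.graft_preLie s t r)
  simp only [Multiset.map_add, Multiset.sum_add, ← ofTree_mul_sum, ← sum_mul_ofTree,
    ← ofTree_mul_ofTree] at h
  rw [associator_apply, associator_apply, sub_eq_sub_iff_add_eq_add, add_comm, ← h, add_comm]

noncomputable instance : LeftPreLieRing (TreeAlgebra ι) where
  assoc_symm' s t r := by
    induction s using induction_ofTree with
    | h0 => simp [associator_apply]
    | hadd s s' h h' =>
      simp only [associator_apply, add_mul, mul_add] at h h' ⊢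
      convert congrArg₂ (· + ·) h h' using 1 <;> abel
    | h a s =>
      induction t using induction_ofTree with
      | h0 => simp [associator_apply]
      | hadd t t' h h' =>
        simp only [associator_apply, add_mul, mul_add] at h h' ⊢
        convert congrArg₂ (· + ·) h h' using 1 <;> abel
      | h b t =>
        induction r using induction_ofTree with
        | h0 => simp [associator_apply]
        | hadd r r' h h' =>
          simp only [associator_apply, mul_add] at h h' ⊢
          convert congrArg₂ (· + ·) h h' using 1 <;> abel
        | h c r =>
          have h := preLie_ofTree s t r
          simp only [associator_apply, smul_mul_assoc, mul_smul_comm] at h ⊢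
          simp only [← smul_sub, h, smul_comm b a]

noncomputable instance : LeftPreLieAlgebra ℝ (TreeAlgebra ι) where

/-- Multilinear extension of the operators `B_+`: `v` is a linear combination of elements of `ι`,
the `τ j` are linear combinations of trees, and all of them are expanded. -/
noncomputable def bPlusLin (v : ι →₀ ℝ) {k : ℕ} (τ : Fin k → TreeAlgebra ι) : TreeAlgebra ι :=
  ∑ i ∈ v.support, ∑ t ∈ Fintype.piFinset fun j => Finsupp.support (τ j),
    (v i * ∏ j, (show DecTree ι →₀ ℝ from τ j) (t j)) • ofTree (DecTree.bPlus i t)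

theorem bPlusLin_perm (v : ι →₀ ℝ) {k : ℕ} (τ : Fin k → TreeAlgebra ι)
    (σ : Equiv.Perm (Fin k)) : bPlusLin v (fun j => τ (σ j)) = bPlusLin v τ := by
  unfold bPlusLin
  refine Finset.sum_congr rfl fun i _ => ?_
  symm
  refine Finset.sum_bij (fun t _ => fun j => t (σ j)) ?_ ?_ ?_ ?_
  · intro t ht
    rw [Fintype.mem_piFinset] at ht ⊢
    exact fun j => ht (σ j)
  · intro t _ t' _ h
    funext j
    simpa using congrFun h (σ⁻¹ j)
  · intro t ht
    rw [Fintype.mem_piFinset] at ht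
    refine ⟨fun j => t (σ⁻¹ j), ?_, by simp⟩
    rw [Fintype.mem_piFinset]
    intro j
    simpa using ht (σ⁻¹ j)
  · intro t _
    rw [DecTree.bPlus_perm]
    congr 2
    exact (Equiv.prod_comp σ fun j => (show DecTree ι →₀ ℝ from τ j) (t j)).symm

variable {V : Type v} [AddCommGroup V] [Module ℝ V]

/-- Multilinear expansion, over a basis `b` of `V`, of a planar tree decorated by `V`. -/
noncomputable def expandPlanar (b : Module.Basis ι ℝ V) : PlanarTree V → TreeAlgebra ι
  | .node X _ c => bPlusLin (b.repr X) fun j => expandPlanar b (c j)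

theorem expandPlanar_iso (b : Module.Basis ι ℝ V) {t t' : PlanarTree V}
    (h : PlanarTree.Iso t t') : expandPlanar b t = expandPlanar b t' := by
  induction h with
  | node X k c c' σ _ ih =>
    rw [expandPlanar, expandPlanar, funext ih]
    exact bPlusLin_perm _ (fun j => expandPlanar b (c' j)) σ

/-- A tree whose vertices are decorated by arbitrary elements of `V`, seen as an element of the
free pre-Lie algebra on `V`: all decorations are expanded over the basis `b` of `V`,
multilinearly. -/
noncomputable def ofDecTree (b : Module.Basis ι ℝ V) (t : DecTree V) : TreeAlgebra ι :=
  Quotient.lift (expandPlanar b) (fun _ _ h => expandPlanar_iso b h) t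

end TreeAlgebra

/-! ### The pre-Lie algebra of vector fields on `ℝⁿ` -/

/-- The space of smooth vector fields on `ℝⁿ`, seen as smooth maps from `ℝⁿ` to `ℝⁿ`. -/
def smoothSubmodule (n : ℕ) :
    Submodule ℝ (EuclideanSpace ℝ (Fin n) → EuclideanSpace ℝ (Fin n)) where
  carrier := {X | ContDiff ℝ ∞ X}
  add_mem' {X Y} (hX : ContDiff ℝ ∞ X) (hY : ContDiff ℝ ∞ Y) := hX.add hY
  zero_mem' := by
    change ContDiff ℝ ∞ fun _ => (0 : EuclideanSpace ℝ (Fin n))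
    exact contDiff_const
  smul_mem' c {X} (hX : ContDiff ℝ ∞ X) := hX.const_smul c

/-- Smooth vector fields on `ℝⁿ`; `X = ∑ i, f i ∂_i` has components `f i x = X x i`. -/
def VecField (n : ℕ) : Type := smoothSubmodule n

namespace VecField

variable {n : ℕ}

noncomputable instance : AddCommGroup (VecField n) :=
  inferInstanceAs (AddCommGroup (smoothSubmodule n))

noncomputable instance : Module ℝ (VecField n) :=
  inferInstanceAs (Module ℝ (smoothSubmodule n))

instance : CoeFun (VecField n) fun _ => EuclideanSpace ℝ (Fin n) → EuclideanSpace ℝ (Fin n) :=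
  ⟨fun X => X.1⟩

theorem contDiff (X : VecField n) : ContDiff ℝ ∞ X := X.2

theorem ext {X Y : VecField n} (h : ∀ x, X x = Y x) : X = Y := Subtype.ext (funext h)

theorem add_apply (X Y : VecField n) (x : EuclideanSpace ℝ (Fin n)) : (X + Y) x = X x + Y x := rfl

theorem sub_apply (X Y : VecField n) (x : EuclideanSpace ℝ (Fin n)) : (X - Y) x = X x - Y x := rfl

theorem smul_apply (a : ℝ) (X : VecField n) (x : EuclideanSpace ℝ (Fin n)) :
    (a • X) x = a • X x := rfl

theorem differentiable (X : VecField n) : Differentiable ℝ X := X.contDiff.differentiable (by simp)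

theorem contDiff_fderiv (X : VecField n) : ContDiff ℝ ∞ (fderiv ℝ X) :=
  X.contDiff.fderiv_right (by simp)

/-- The pre-Lie product `X ▷ Y = ∇_X Y` for the canonical flat torsion-free connection:
the derivative of `Y` along `X`. -/
noncomputable instance : Mul (VecField n) where
  mul X Y := ⟨fun x => fderiv ℝ Y x (X x), Y.contDiff_fderiv.clm_apply X.contDiff⟩

theorem mul_apply (X Y : VecField n) (x : EuclideanSpace ℝ (Fin n)) :
    (X * Y) x = fderiv ℝ Y x (X x) := rfl

theorem fderiv_add' (X Y : VecField n) (x : EuclideanSpace ℝ (Fin n)) :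
    fderiv ℝ (X + Y : VecField n) x = fderiv ℝ X x + fderiv ℝ Y x :=
  fderiv_add (X.differentiable x) (Y.differentiable x)

noncomputable instance : NonUnitalNonAssocRing (VecField n) where
  left_distrib X Y Z := ext fun x => by
    simp only [mul_apply, add_apply, fderiv_add', _root_.add_apply]
  right_distrib X Y Z := ext fun x => by
    simp only [mul_apply, add_apply, map_add]
  zero_mul X := ext fun x => map_zero (fderiv ℝ X x)
  mul_zero X := ext fun x => by
    rw [mul_apply]
    have : fderiv ℝ (0 : VecField n) x = 0 := fderiv_const_apply _
    rw [this]
    rfl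

theorem fderiv_mul' (X Y : VecField n) (x v : EuclideanSpace ℝ (Fin n)) :
    fderiv ℝ (X * Y : VecField n) x v =
      fderiv ℝ (fderiv ℝ Y) x v (X x) + fderiv ℝ Y x (fderiv ℝ X x v) := by
  have h : fderiv ℝ (X * Y : VecField n) x = _ :=
    fderiv_clm_apply ((Y.contDiff_fderiv.differentiable (by simp)) x) (X.differentiable x)
  rw [h]
  simp [add_comm]

noncomputable instance : LeftPreLieRing (VecField n) where
  assoc_symm' X Y Z := ext fun x => by
    have hs : fderiv ℝ (fderiv ℝ Z) x (X x) (Y x) = fderiv ℝ (fderiv ℝ Z) x (Y x) (X x) :=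
      (Z.contDiff.contDiffAt.isSymmSndFDerivAt (by simp; exact WithTop.coe_le_coe.2 le_top)) (X x) (Y x)
    simp only [associator_apply, sub_apply, mul_apply, fderiv_mul', hs]
    abel

instance : IsScalarTower ℝ (VecField n) (VecField n) where
  smul_assoc a X Y := ext fun x => map_smul (fderiv ℝ Y x) a (X x)

instance : SMulCommClass ℝ (VecField n) (VecField n) where
  smul_comm a X Y := ext fun x => by
    have h : fderiv ℝ (a • Y : VecField n) x = a • fderiv ℝ Y x :=
      fderiv_const_smul (Y.differentiable x) a
    change a • fderiv ℝ Y x (X x) = fderiv ℝ (a • Y : VecField n) x (X x)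
    rw [h]
    rfl

noncomputable instance : LeftPreLieAlgebra ℝ (VecField n) where

end VecField

/-- `Y` is a Cayley map: a pre-Lie algebra morphism from the free pre-Lie algebra on the space of
vector fields on `ℝⁿ` (with basis the rooted trees decorated by the basis `b` of this space) to
vector fields on `ℝⁿ`, such that `Y(•_X) = X` for any vector field `X`. -/
def IsCayleyMap {n : ℕ} {ι : Type u} (b : Module.Basis ι ℝ (VecField n))
    (Y : TreeAlgebra ι →ₙₐ[ℝ] VecField n) : Prop :=
  ∀ X : VecField n, Y (TreeAlgebra.ofDecTree b (DecTree.bullet X)) = X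

end CayleyMap

/-! Write `X.iterDeriv k Z` for the vector field X⁽ᵏ⁾(Z₁, …, Zₖ). By the Leibniz rule, W ▷ X⁽ᵏ⁾(Z₁,
…, Zₖ) equals X⁽ᵏ⁺¹⁾(W, Z₁, …, Zₖ) plus the sum over i of X⁽ᵏ⁾(Z₁, …, W ▷ Zᵢ, …, Zₖ)
(`VecField.mul_iterDeriv`). Grafting s on B₊(t₁, …, tₖ) obeys the same recursion: s is attached to
the root or inside one branch (`DecTree.graft_bPlus`).

The comparison of the two recursions, `sum_map_graft_bPlus`, serves twice. For existence, the
formula defines a vector field for each tree, independent of the planar order since higher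
derivatives are symmetric, and the comparison yields multiplicativity. For uniqueness,
multiplicativity is given and the comparison yields the formula by induction on the number of
branches, so a morphism is determined by its values on one-vertex trees.

Arbitrary decorations follow from basis decorations because X⁽ᵏ⁾(Z₁, …, Zₖ) is linear in X and in
each Zⱼ (`linearMap_bPlusLin`). -/

namespace CayleyMap

/-! ### Symmetry and Leibniz rule for higher derivatives -/

section IteratedDerivatives

variable {E F : Type*} [NormedAddCommGroup E] [NormedSpace ℝ E] [NormedAddCommGroup F]
  [NormedSpace ℝ F]

theorem differentiable_iteratedFDeriv_of_smooth {f : E → F} (hf : ContDiff ℝ ∞ f) (k : ℕ) :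
    Differentiable ℝ (iteratedFDeriv ℝ k f) :=
  hf.differentiable_iteratedFDeriv (WithTop.coe_lt_coe.2 (ENat.natCast_lt_top k))

theorem contDiff_iteratedFDeriv_of_smooth {f : E → F} (hf : ContDiff ℝ ∞ f) (k : ℕ) :
    ContDiff ℝ ∞ (iteratedFDeriv ℝ k f) :=
  hf.iteratedFDeriv_right (m := ∞) (by exact_mod_cast le_top)

/-- The first two arguments of an iterated derivative of a smooth function, as a second
derivative. -/
theorem iteratedFDeriv_add_two_apply {f : E → F} (hf : ContDiff ℝ ∞ f) {k : ℕ} (x : E)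
    (m : Fin (k + 2) → E) :
    iteratedFDeriv ℝ (k + 2) f x m =
      fderiv ℝ (fderiv ℝ (iteratedFDeriv ℝ k f)) x (m 0) (m 1) (Fin.tail (Fin.tail m)) := by
  have hd : DifferentiableAt ℝ (fderiv ℝ (iteratedFDeriv ℝ k f)) x :=
    ((contDiff_iteratedFDeriv_of_smooth hf k).fderiv_right (m := ∞) (by simp)).differentiable
      (by simp) x
  -- Freezing the last k + 1 arguments before the outer differentiation makes the inner derivative
  -- an evaluation at constant vectors.
  have h : (fun y => iteratedFDeriv ℝ (k + 1) f y (Fin.tail m)) =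
      fun y => fderiv ℝ (iteratedFDeriv ℝ k f) y (m 1) (Fin.tail (Fin.tail m)) := by
    funext y
    rw [iteratedFDeriv_succ_apply_left]
    rfl
  rw [iteratedFDeriv_succ_apply_left, ← fderiv_continuousMultilinear_apply_const_apply
    (differentiable_iteratedFDeriv_of_smooth hf (k + 1) x), h,
    fderiv_continuousMultilinear_apply_const_apply (hd.clm_apply (differentiableAt_const _)),
    fderiv_clm_apply hd (differentiableAt_const _)]
  simp

/-- Exchanging the first two arguments is the symmetry of the second derivative of a lower iterated
derivative. Any other adjacent transposition fixes the first argument, so its invariance is obtained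
by differentiating the identity one order below. -/
theorem iteratedFDeriv_comp_swap {f : E → F} (hf : ContDiff ℝ ∞ f) {k : ℕ} (i : Fin k) (x : E)
    (m : Fin (k + 1) → E) :
    iteratedFDeriv ℝ (k + 1) f x (m ∘ Equiv.swap i.castSucc i.succ) =
      iteratedFDeriv ℝ (k + 1) f x m := by
  -- The lower-order identity is needed at every point, since it is differentiated.
  induction k generalizing x with
  | zero => exact i.elim0
  | succ k ih =>
    refine Fin.cases ?_ (fun j => ?_) i
    · have hs : IsSymmSndFDerivAt ℝ (iteratedFDeriv ℝ k f) x :=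
        (contDiff_iteratedFDeriv_of_smooth hf k).contDiffAt.isSymmSndFDerivAt
          (by simp; exact WithTop.coe_le_coe.2 le_top)
      rw [iteratedFDeriv_add_two_apply hf, iteratedFDeriv_add_two_apply hf, hs.eq]
      congr 1
    · have h0 : (m ∘ Equiv.swap j.succ.castSucc j.succ.succ) 0 = m 0 := by
        rw [Function.comp_apply, Equiv.swap_apply_of_ne_of_ne] <;> simp [Fin.ext_iff]
      have ht : Fin.tail (m ∘ Equiv.swap j.succ.castSucc j.succ.succ) =
          Fin.tail m ∘ Equiv.swap j.castSucc j.succ := by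
        funext l
        simp only [Fin.tail, Function.comp_apply]
        rw [(Fin.succ_injective _).map_swap]
        rfl
      have hd := differentiable_iteratedFDeriv_of_smooth hf (k + 1) x
      rw [iteratedFDeriv_succ_apply_left, iteratedFDeriv_succ_apply_left, h0, ht,
        ← fderiv_continuousMultilinear_apply_const_apply hd,
        ← fderiv_continuousMultilinear_apply_const_apply hd]
      simp only [ih]

/-- The iterated derivatives of a smooth function are symmetric. -/
theorem iteratedFDeriv_comp_perm_of_smooth {f : E → F} (hf : ContDiff ℝ ∞ f) {k : ℕ} (x : E)
    (m : Fin k → E) (σ : Equiv.Perm (Fin k)) :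
    iteratedFDeriv ℝ k f x (m ∘ σ) = iteratedFDeriv ℝ k f x m := by
  cases k with
  | zero => congr 1; exact Subsingleton.elim _ _
  | succ k =>
    -- Adjacent transpositions generate the symmetric group even as a monoid, so the induction has
    -- no case for inverses.
    have hσ : σ ∈ Submonoid.closure
        (Set.range fun i : Fin k => Equiv.swap i.castSucc i.succ) := by
      rw [Equiv.Perm.mclosure_swap_castSucc_succ]; trivial
    induction hσ using Submonoid.closure_induction generalizing m with
    | mem τ hτ =>
      obtain ⟨i, rfl⟩ := hτ
      exact iteratedFDeriv_comp_swap hf i x m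
    | one => rfl
    | mul τ ρ _ _ hτ hρ => exact (hρ (m ∘ τ)).trans (hτ m)

/-- Evaluation (p, v) ↦ p v is analytic jointly in the multilinear map and its arguments, hence
smooth. -/
theorem contDiff_iteratedFDeriv_apply [CompleteSpace F] {f : E → F} (hf : ContDiff ℝ ∞ f) {k : ℕ}
    {g : Fin k → E → E} (hg : ∀ j, ContDiff ℝ ∞ (g j)) :
    ContDiff ℝ ∞ fun x => iteratedFDeriv ℝ k f x fun j => g j x := by
  have h : ContDiff ℝ ∞ fun p : (E [×k]→L[ℝ] F) × (Fin k → E) => p.1 p.2 :=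
    contDiff_iff_contDiffAt.2 fun p => (ContinuousLinearMap.analyticAt_uncurry_of_multilinear
      (ContinuousLinearMap.id ℝ (E [×k]→L[ℝ] F))).contDiffAt
  exact h.comp ((contDiff_iteratedFDeriv_of_smooth hf k).prodMk (contDiff_pi.2 hg))

/-- Leibniz rule: differentiating the form itself inserts v as a new first argument, and
differentiating the arguments gives the sum. -/
theorem fderiv_iteratedFDeriv_apply {f : E → F} (hf : ContDiff ℝ ∞ f) {k : ℕ}
    {g : Fin k → E → E} (hg : ∀ j, ContDiff ℝ ∞ (g j)) (x v : E) :
    fderiv ℝ (fun x => iteratedFDeriv ℝ k f x fun j => g j x) x v =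
      iteratedFDeriv ℝ (k + 1) f x (Fin.cons v fun j => g j x) +
        ∑ i, iteratedFDeriv ℝ k f x
          (Function.update (fun j => g j x) i (fderiv ℝ (g i) x v)) := by
  rw [((differentiable_iteratedFDeriv_of_smooth hf k x).hasFDerivAt.continuousMultilinearMap_apply
    fun j => ((hg j).differentiable (by simp) x).hasFDerivAt).fderiv,
    iteratedFDeriv_succ_apply_left]
  simp

end IteratedDerivatives

/-! ### Higher derivatives as multilinear operations on vector fields -/

namespace VecField

variable {n : ℕ}

/-- The vector field `x ↦ X⁽ᵏ⁾(x)(Z₁(x), …, Zₖ(x))`, as a multilinear function of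
`Z₁, …, Zₖ`. -/
noncomputable def iterDeriv (X : VecField n) (k : ℕ) :
    MultilinearMap ℝ (fun _ : Fin k => VecField n) (VecField n) where
  toFun Z := ⟨fun x => iteratedFDeriv ℝ k X x fun j => Z j x,
    contDiff_iteratedFDeriv_apply X.contDiff fun j => (Z j).contDiff⟩
  map_update_add' Z i A B := ext fun x => by
    have h (C : VecField n) : (fun j => Function.update Z i C j x) =
        Function.update (fun j => Z j x) i (C x) :=
      funext fun j => Function.apply_update (fun _ (W : VecField n) => W x) Z i C j
    exact (congrArg _ (h _)).trans (((iteratedFDeriv ℝ k X x).map_update_add _ i (A x) (B x)).trans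
      (congrArg₂ (· + ·) (congrArg _ (h A).symm) (congrArg _ (h B).symm)))
  map_update_smul' Z i c A := ext fun x => by
    have h (C : VecField n) : (fun j => Function.update Z i C j x) =
        Function.update (fun j => Z j x) i (C x) :=
      funext fun j => Function.apply_update (fun _ (W : VecField n) => W x) Z i C j
    exact (congrArg _ (h _)).trans (((iteratedFDeriv ℝ k X x).map_update_smul _ i c (A x)).trans
      (congrArg (c • ·) (congrArg _ (h A).symm)))

/-- Coordinate projections are continuous and linear, so they commute with iterated derivatives. -/
theorem iterDeriv_apply_coord (X : VecField n) {k : ℕ} (Z : Fin k → VecField n)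
    (x : EuclideanSpace ℝ (Fin n)) (i : Fin n) :
    X.iterDeriv k Z x i = iteratedFDeriv ℝ k (fun y => X y i) x fun j => Z j x := by
  have h := (EuclideanSpace.proj i : EuclideanSpace ℝ (Fin n) →L[ℝ] ℝ).iteratedFDeriv_comp_left
    (X.contDiff.contDiffAt (x := x)) (i := k) (by exact_mod_cast le_top)
  exact (congrArg (fun L => L fun j => Z j x) h).symm

theorem iterDeriv_zero (X : VecField n) (Z : Fin 0 → VecField n) : X.iterDeriv 0 Z = X :=
  ext fun _ => rfl

theorem iterDeriv_perm (X : VecField n) {k : ℕ} (Z : Fin k → VecField n)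
    (σ : Equiv.Perm (Fin k)) : X.iterDeriv k (fun j => Z (σ j)) = X.iterDeriv k Z :=
  ext fun x => iteratedFDeriv_comp_perm_of_smooth X.contDiff x (fun j => Z j x) σ

/-- The analytic counterpart of `DecTree.graft_bPlus`: the first term matches grafting on the root,
the sum matches grafting inside a branch. -/
theorem mul_iterDeriv (W X : VecField n) {k : ℕ} (Z : Fin k → VecField n) :
    W * X.iterDeriv k Z = X.iterDeriv (k + 1) (Fin.cons W Z : Fin (k + 1) → VecField n) +
      ∑ i, X.iterDeriv k (Function.update Z i (W * Z i)) := ext fun x => by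
  have hsum (g : Fin k → VecField n) : (∑ i, g i) x = ∑ i, g i x :=
    map_sum (⟨⟨fun X : VecField n => X x, rfl⟩, fun _ _ => rfl⟩ : VecField n →+ _) g Finset.univ
  rw [add_apply, hsum, mul_apply]
  refine (fderiv_iteratedFDeriv_apply X.contDiff (fun j => (Z j).contDiff) x (W x)).trans ?_
  refine congrArg₂ (· + ·) (congrArg (iteratedFDeriv ℝ (k + 1) X x) ?_) ?_
  · funext j
    refine Fin.cases rfl (fun _ => rfl) j
  · refine Finset.sum_congr rfl fun i _ => ?_
    refine congrArg (iteratedFDeriv ℝ k X x) ?_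
    funext j
    exact (Function.apply_update (fun _ (V : VecField n) => V x) Z i (W * Z i) j).symm

theorem iterDeriv_linear {k : ℕ} (Z : Fin k → VecField n) :
    IsLinearMap ℝ fun X : VecField n => X.iterDeriv k Z where
  map_add X Y := ext fun x => by
    have h := iteratedFDeriv_add_apply (i := k) (x := x)
      (X.contDiff.contDiffAt.of_le (by exact_mod_cast le_top))
      (Y.contDiff.contDiffAt.of_le (by exact_mod_cast le_top))
    exact congrArg (fun L => L fun j => Z j x) h
  map_smul c X := ext fun x => by
    have h := iteratedFDeriv_const_smul_apply (i := k) (a := c) (x := x)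
      (X.contDiff.contDiffAt.of_le (by exact_mod_cast le_top))
    exact congrArg (fun L => L fun j => Z j x) h

end VecField

/-! ### Multilinear expansion of decorations -/

namespace TreeAlgebra

universe u

variable {n : ℕ} {ι : Type u}

theorem ofDecTree_bPlus {V : Type*} [AddCommGroup V] [Module ℝ V] (b : Module.Basis ι ℝ V)
    (X : V) {k : ℕ} (t : Fin k → DecTree V) :
    ofDecTree b (DecTree.bPlus X t) = bPlusLin (b.repr X) fun j => ofDecTree b (t j) := by
  obtain ⟨c, rfl⟩ : ∃ c : Fin k → PlanarTree V, t = fun i => DecTree.mk (c i) :=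
    ⟨fun i => (t i).out, funext fun i => (Quotient.out_eq (t i)).symm⟩
  rw [← DecTree.mk_node]
  rfl

/-- `IsCayleyMap` concerns vertices decorated by vectors, while the basis trees carry indices; this
identifies the two for basis vectors. -/
theorem ofDecTree_bullet {V : Type*} [AddCommGroup V] [Module ℝ V] (b : Module.Basis ι ℝ V)
    (i : ι) : ofDecTree b (DecTree.bullet (b i)) = ofTree (DecTree.bullet i) := by
  rw [DecTree.bullet, ofDecTree_bPlus, bPlusLin, b.repr_self,
    Finsupp.support_single _ one_ne_zero]
  simp [DecTree.bullet, Subsingleton.elim default (Fin.elim0 : Fin 0 → DecTree ι)]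

theorem eq_sum_smul_ofTree (s : TreeAlgebra ι) :
    s = ∑ t ∈ Finsupp.support s, (show DecTree ι →₀ ℝ from s) t • ofTree t := by
  conv_lhs => rw [← Finsupp.sum_single (show DecTree ι →₀ ℝ from s)]
  refine Finset.sum_congr rfl fun t _ => ?_
  exact (Finsupp.smul_single_one _ _).symm

/-- Both sides are linear in X and multilinear in τ, so the case of basis vectors and trees
suffices. Multiplicativity of Y plays no role. -/
theorem linearMap_bPlusLin (b : Module.Basis ι ℝ (VecField n))
    (Y : TreeAlgebra ι →ₗ[ℝ] VecField n)
    (hY : ∀ (i : ι) (k : ℕ) (t : Fin k → DecTree ι),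
      Y (ofTree (DecTree.bPlus i t)) = (b i).iterDeriv k fun j => Y (ofTree (t j)))
    (X : VecField n) {k : ℕ} (τ : Fin k → TreeAlgebra ι) :
    Y (bPlusLin (b.repr X) τ) = X.iterDeriv k fun j => Y (τ j) := by
  classical
  have hτ : (fun j => Y (τ j)) = fun j => ∑ t ∈ Finsupp.support (τ j),
      (show DecTree ι →₀ ℝ from τ j) t • Y (ofTree t) := by
    funext j
    conv_lhs => rw [eq_sum_smul_ofTree (τ j)]
    simp only [map_sum, map_smul]
  have hX : X.iterDeriv k (fun j => Y (τ j)) = ∑ i ∈ (b.repr X).support,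
      b.repr X i • (b i).iterDeriv k fun j => Y (τ j) := by
    conv_lhs => rw [← b.linearCombination_repr X]
    exact (map_sum (VecField.iterDeriv_linear fun j => Y (τ j)).mk' _ _).trans
      (Finset.sum_congr rfl fun i _ => (VecField.iterDeriv_linear _).map_smul _ _)
  rw [hX, bPlusLin, map_sum]
  refine Finset.sum_congr rfl fun i _ => ?_
  -- Multilinear expansion produces a sum over the same families of trees as in `bPlusLin`.
  rw [hτ, MultilinearMap.map_sum_finset, Finset.smul_sum, map_sum]
  refine Finset.sum_congr rfl fun t _ => ?_
  rw [map_smul, hY, MultilinearMap.map_smul_univ, smul_smul]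

/-! ### Grafting compared with the Leibniz rule -/

/-- The branch terms of the two recursions agree, by `ht` and multilinearity, and cancel. What
remains makes two facts equivalent: multiplicativity on s and B₊(t), and the derivative formula with
k + 1 branches. Keeping all four terms lets either one be cancelled. -/
theorem sum_map_graft_bPlus {φ : DecTree ι → VecField n} {X : VecField n} {d : ι} {k : ℕ}
    (hφ : ∀ t : Fin k → DecTree ι, φ (DecTree.bPlus d t) = X.iterDeriv k fun j => φ (t j))
    (s : DecTree ι) (t : Fin k → DecTree ι)
    (ht : ∀ i, ((DecTree.graft s (t i)).map φ).sum = φ s * φ (t i)) :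
    ((DecTree.graft s (DecTree.bPlus d t)).map φ).sum +
        X.iterDeriv (k + 1) (fun j => φ ((Fin.cons s t : Fin (k + 1) → DecTree ι) j)) =
      φ (DecTree.bPlus d (Fin.cons s t : Fin (k + 1) → DecTree ι)) +
        φ s * φ (DecTree.bPlus d t) := by
  have hcons : (fun j => φ ((Fin.cons s t : Fin (k + 1) → DecTree ι) j)) =
      (Fin.cons (φ s) fun j => φ (t j) : Fin (k + 1) → VecField n) :=
    funext fun j => Fin.cases rfl (fun _ => rfl) j
  have hsum : ((∑ i, (DecTree.graft s (t i)).map fun w =>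
        DecTree.bPlus d (Function.update t i w)).map φ).sum =
      ∑ i, X.iterDeriv k (Function.update (fun j => φ (t j)) i (φ s * φ (t i))) := by
    refine (map_sum (Multiset.sumAddMonoidHom.comp (Multiset.mapAddMonoidHom φ)) _ _).trans
      (Finset.sum_congr rfl fun i _ => ?_)
    have h := map_multiset_sum ((X.iterDeriv k).toLinearMap (fun j => φ (t j)) i)
      ((DecTree.graft s (t i)).map φ)
    rw [ht i, Multiset.map_map] at h
    refine Eq.trans ?_ h.symm
    change (Multiset.map φ (Multiset.map _ _)).sum = _
    rw [Multiset.map_map]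
    refine congrArg _ (Multiset.map_congr rfl fun w _ => ?_)
    refine (hφ _).trans (congrArg _ (funext fun j => ?_))
    exact Function.apply_update (fun _ => φ) t i w j
  rw [hcons, hφ, VecField.mul_iterDeriv, DecTree.graft_bPlus, Multiset.map_cons,
    Multiset.sum_cons, hsum]
  abel

/-- A pre-Lie algebra morphism to vector fields is determined on trees by its values on one-vertex
trees. -/
theorem map_ofTree_bPlus (Y : TreeAlgebra ι →ₙₐ[ℝ] VecField n) (d : ι) {k : ℕ}
    (t : Fin k → DecTree ι) :
    Y (ofTree (DecTree.bPlus d t)) =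
      (Y (ofTree (DecTree.bullet d))).iterDeriv k fun j => Y (ofTree (t j)) := by
  have hgraft (s t : DecTree ι) : ((DecTree.graft s t).map fun w => Y (ofTree w)).sum =
      Y (ofTree s) * Y (ofTree t) := by
    rw [← map_mul, ofTree_mul_ofTree, map_multiset_sum, Multiset.map_map]
    rfl
  induction k with
  | zero => rw [VecField.iterDeriv_zero, DecTree.bullet, Subsingleton.elim t Fin.elim0]
  | succ k ih =>
    -- The first branch is viewed as grafted on the tree formed by the other k branches; the
    -- multiplicativity terms then cancel.
    have h := sum_map_graft_bPlus (φ := fun w => Y (ofTree w)) ih (t 0) (Fin.tail t)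
      fun i => hgraft _ _
    rw [hgraft, add_comm, Fin.cons_self_tail] at h
    exact (add_right_cancel h).symm

/-! ### Elementary differentials and construction of the morphism -/

/-- The vector field associated with a planar tree decorated by vector fields `d i`. -/
noncomputable def elementaryDifferentialPlanar (d : ι → VecField n) : PlanarTree ι → VecField n
  | .node i k c => (d i).iterDeriv k fun j => elementaryDifferentialPlanar d (c j)

/-- Symmetry of higher derivatives absorbs the permutation of branches at each vertex. -/
theorem elementaryDifferentialPlanar_iso (d : ι → VecField n) {t t' : PlanarTree ι}
    (h : PlanarTree.Iso t t') :
    elementaryDifferentialPlanar d t = elementaryDifferentialPlanar d t' := by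
  induction h with
  | node i k c c' σ _ ih =>
    rw [elementaryDifferentialPlanar, elementaryDifferentialPlanar, funext ih]
    exact VecField.iterDeriv_perm _ (fun j => elementaryDifferentialPlanar d (c' j)) σ

/-- The vector field associated with a rooted tree decorated by vector fields `d i`. -/
noncomputable def elementaryDifferential (d : ι → VecField n) (t : DecTree ι) : VecField n :=
  Quotient.lift (elementaryDifferentialPlanar d)
    (fun _ _ h => elementaryDifferentialPlanar_iso d h) t

theorem elementaryDifferential_bPlus (d : ι → VecField n) (i : ι) {k : ℕ}
    (t : Fin k → DecTree ι) :
    elementaryDifferential d (DecTree.bPlus i t) =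
      (d i).iterDeriv k fun j => elementaryDifferential d (t j) := by
  obtain ⟨c, rfl⟩ : ∃ c : Fin k → PlanarTree ι, t = fun i => DecTree.mk (c i) :=
    ⟨fun i => (t i).out, funext fun i => (Quotient.out_eq (t i)).symm⟩
  rw [← DecTree.mk_node]
  rfl

/-- Here the derivative formula holds for every number of branches, so its terms cancel in
`sum_map_graft_bPlus` and multiplicativity is left. The induction is on t, the tree that receives
the grafting. -/
theorem sum_elementaryDifferential_graft (d : ι → VecField n) (s t : DecTree ι) :
    ((DecTree.graft s t).map (elementaryDifferential d)).sum =
      elementaryDifferential d s * elementaryDifferential d t := by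
  induction t using DecTree.induction_bPlus with
  | h i k t ih =>
    have h := sum_map_graft_bPlus (elementaryDifferential_bPlus d i) s t ih
    rw [← elementaryDifferential_bPlus, add_comm] at h
    exact add_left_cancel h

/-- The linear extension to `TreeAlgebra ι` of the elementary differentials of trees. -/
noncomputable def cayleyLinearMap (d : ι → VecField n) : TreeAlgebra ι →ₗ[ℝ] VecField n :=
  Finsupp.linearCombination ℝ (elementaryDifferential d)

theorem cayleyLinearMap_ofTree (d : ι → VecField n) (t : DecTree ι) :
    cayleyLinearMap d (ofTree t) = elementaryDifferential d t :=
  (Finsupp.linearCombination_single ℝ (1 : ℝ) t).trans (one_smul ℝ _)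

theorem cayleyLinearMap_mul (d : ι → VecField n) (s t : TreeAlgebra ι) :
    cayleyLinearMap d (s * t) = cayleyLinearMap d s * cayleyLinearMap d t := by
  induction s using induction_ofTree with
  | h0 => simp
  | hadd s s' h h' => rw [add_mul, map_add, map_add, add_mul, h, h']
  | h a s =>
    induction t using induction_ofTree with
    | h0 => simp
    | hadd t t' h h' => rw [mul_add, map_add, map_add, mul_add, h, h']
    | h b t =>
      simp only [smul_mul_assoc, mul_smul_comm, map_smul]
      rw [ofTree_mul_ofTree, map_multiset_sum, Multiset.map_map, cayleyLinearMap_ofTree,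
        cayleyLinearMap_ofTree, ← sum_elementaryDifferential_graft]
      simp only [Function.comp_def, cayleyLinearMap_ofTree]

/-- The pre-Lie algebra morphism sending the one-vertex tree decorated by `i` to `d i`. -/
noncomputable def cayleyMap (d : ι → VecField n) : TreeAlgebra ι →ₙₐ[ℝ] VecField n :=
  { toFun := cayleyLinearMap d
    map_smul' := map_smul (cayleyLinearMap d)
    map_zero' := map_zero (cayleyLinearMap d)
    map_add' := map_add (cayleyLinearMap d)
    map_mul' := cayleyLinearMap_mul d }

theorem cayleyMap_ofTree (d : ι → VecField n) (t : DecTree ι) :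
    cayleyMap d (ofTree t) = elementaryDifferential d t :=
  cayleyLinearMap_ofTree d t

theorem cayleyMap_ofDecTree_bPlus (b : Module.Basis ι ℝ (VecField n)) (X : VecField n) {k : ℕ}
    (t : Fin k → DecTree (VecField n)) :
    cayleyMap b (ofDecTree b (DecTree.bPlus X t)) =
      X.iterDeriv k fun j => cayleyMap b (ofDecTree b (t j)) := by
  rw [ofDecTree_bPlus]
  refine linearMap_bPlusLin b (cayleyLinearMap b) (fun i k t => ?_) X _
  simp only [cayleyLinearMap_ofTree, elementaryDifferential_bPlus]

/-! ### Existence and uniqueness of the Cayley map -/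

theorem isCayleyMap_cayleyMap (b : Module.Basis ι ℝ (VecField n)) :
    IsCayleyMap b (cayleyMap b) := fun X => by
  rw [DecTree.bullet, cayleyMap_ofDecTree_bPlus, VecField.iterDeriv_zero]

theorem eq_cayleyMap_of_isCayleyMap {b : Module.Basis ι ℝ (VecField n)}
    {Y : TreeAlgebra ι →ₙₐ[ℝ] VecField n} (hY : IsCayleyMap b Y) : Y = cayleyMap b := by
  have htree (t : DecTree ι) : Y (ofTree t) = elementaryDifferential b t := by
    induction t using DecTree.induction_bPlus with
    | h i k t ih =>
      -- The derivative formula holds for any morphism, and `hY` fixes its root term as `b i`; the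
      -- branches agree by induction.
      rw [map_ofTree_bPlus, ← ofDecTree_bullet b, hY, elementaryDifferential_bPlus, funext ih]
  ext s
  induction s using induction_ofTree with
  | h0 => rw [map_zero, map_zero]
  | hadd s t hs ht => rw [map_add, map_add, hs, ht]
  | h a t => rw [map_smul, map_smul, htree, cayleyMap_ofTree]

end TreeAlgebra

end CayleyMap

theorem mainTheorem9 (n : ℕ) {ι : Type*} (b : Module.Basis ι ℝ (CayleyMap.VecField n)) :
    ∃ Y : CayleyMap.TreeAlgebra ι →ₙₐ[ℝ] CayleyMap.VecField n,
      CayleyMap.IsCayleyMap b Y ∧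
      (∀ Y' : CayleyMap.TreeAlgebra ι →ₙₐ[ℝ] CayleyMap.VecField n,
        CayleyMap.IsCayleyMap b Y' → Y' = Y) ∧
      ∀ (X : CayleyMap.VecField n) (k : ℕ)
        (t : Fin k → CayleyMap.DecTree (CayleyMap.VecField n))
        (x : EuclideanSpace ℝ (Fin n)) (i : Fin n),
        Y (CayleyMap.TreeAlgebra.ofDecTree b (CayleyMap.DecTree.bPlus X t)) x i =
          iteratedFDeriv ℝ k (fun y => X y i) x
            (fun j => Y (CayleyMap.TreeAlgebra.ofDecTree b (t j)) x) := by
  refine ⟨CayleyMap.TreeAlgebra.cayleyMap b, CayleyMap.TreeAlgebra.isCayleyMap_cayleyMap b,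
    fun Y' hY' => CayleyMap.TreeAlgebra.eq_cayleyMap_of_isCayleyMap hY', fun X k t x i => ?_⟩
  rw [CayleyMap.TreeAlgebra.cayleyMap_ofDecTree_bPlus, CayleyMap.VecField.iterDeriv_apply_coord]
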